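/- **Setting.** Let $\mathcal H$ and $V$ be separable Hilbert spaces. Let $L:D(L)\subset\mathcal H\to\mathcal H$ be the infinitesimal generator of a $C_0$-semigroup $(T(t))_{t\ge 0}$ of bounded linear operators on $\mathcal H$, and let $M\ge 1$, $\omega\ge 0$ be such that $\|T(t)\|\le Me^{\omega t}$ for all $t\ge 0$. Let $F:\mathcal H\to\mathcal H$, let $\mathfrak C:V\to\mathcal H$ with $\mathfrak C(0)=0$, let $U\subset V$ and $1\le q\le\infty$, and for $T>0$ put $$\mathcal U_{ad}=\{u\in L^q(0,T;V):\ u(s)\in U\text{ for a.e. }s\in[0,T]\}.$$ For $x\in\mathcal H$ and $u\in\mathcal U_{ad}$, a *mild solution* $y(\cdot;x,u)$ is a function $y\in C([0,T],\mathcal H)$ with $$y(t)=T(t)x+\int_0^tT(t-s)F(y(s))\,\mathrm ds+\int_0^tT(t-s)\mathfrak C(u(s))\,\mathrm ds,\qquad t\in[0,T].$$ Let $(\mathcal H_N)_{N\ge 1}$ be finite-dimensional subspaces of $\mathcal H$ with $\mathcal H_N\subset D(L)$, let $\Pi_N$ be the orthogonal projector of $\mathcal H$ onto $\mathcal H_N$,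 assume $\Pi_Nx\to x$ for every $x\in\mathcal H$, and put $L_N:=\Pi_NL\Pi_N$. The *Galerkin solution* $y_N(\cdot;\Pi_Nx,u)\in C([0,T],\mathcal H)$ is a solution of $$\frac{\mathrm dy_N}{\mathrm dt}=L_Ny_N+\Pi_NF(y_N)+\Pi_N\mathfrak C(u(t)),\qquad y_N(0)=\Pi_Nx,$$ in the Carathéodory sense, that is, of $y_N(t)=\Pi_Nx+\int_0^t\big(L_Ny_N(s)+\Pi_NF(y_N(s))+\Pi_N\mathfrak C(u(s))\big)\,\mathrm ds$ for $t\in[0,T]$. **Theorem.** Assume in addition that: 1. for each $N\ge1$, the flow $e^{L_Nt}$ on $\mathcal H_N$ extends to a $C_0$-semigroup $T_N(t)$ on $\mathcal H$, and $\|T_N(t)\|\le Me^{\omega t}$ for all $N\ge 1$, $t\ge0$, with the same $M$ and $\omega$ as above; 2. $\lim_{N\to\infty}\|L_N\phi-L\phi\|_{\mathcal H}=0$ for every $\phi\in D(L)$; 3. $F$ is Lipschitz on every ball of $\mathcal H$ centered at the origin; 4. $U$ is compact; 5. for every $T>0$, $x\in\mathcal H$ and $u\in\mathcal U_{ad}$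 there exist a unique mild solution $y(\cdot;x,u)$ and, for each $N\ge 1$, a unique Galerkin solution $y_N(\cdot;\Pi_Nx,u)$, and there is a constant $\mathcal C=\mathcal C(T,x)$ such that $\|y(t;x,u)\|_{\mathcal H}\le\mathcal C$ and $\|y_N(t;\Pi_Nx,u)\|_{\mathcal H}\le\mathcal C$ for all $t\in[0,T]$, $N\ge1$ and $u\in\mathcal U_{ad}$; 6. for every $T>0$ and $x\in\mathcal H$, $\displaystyle\lim_{N\to\infty}\sup_{u\in\mathcal U_{ad}}\sup_{t\in[0,T]}\|(\mathrm{Id}_{\mathcal H}-\Pi_N)y(t;x,u)\|_{\mathcal H}=0$; 7. $\mathfrak C$ is continuous. Then, for every $T>0$ and $x\in\mathcal H$, $$\lim_{N\to\infty}\ \sup_{u\in\mathcal U_{ad}}\ \sup_{t\in[0,T]}\ \|y_N(t;\Pi_Nx,u)-y(t;x,u)\|_{\mathcal H}=0 .$$ -/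

import Mathlib

open Filter Topology MeasureTheory Set
open scoped ENNReal

section Semigroups

variable {𝕜 H : Type*} [RCLike 𝕜] [NormedAddCommGroup H] [InnerProductSpace 𝕜 H]

/-- A `C₀`-semigroup of bounded linear operators `S t`, `t ≥ 0`, on `H`
(the values of `S` at negative times are irrelevant). -/
structure IsC0Semigroup (S : ℝ → H →L[𝕜] H) : Prop where
  map_zero : S 0 = ContinuousLinearMap.id 𝕜 H
  map_add : ∀ s t : ℝ, 0 ≤ s → 0 ≤ t → S (s + t) = (S s).comp (S t)
  tendsto_zero : ∀ x : H, Tendsto (fun t : ℝ => S t x) (𝓝[>] 0) (𝓝 x)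

/-- The unbounded operator `L : D(L) ⊂ H → H` is the infinitesimal generator of `S`: a vector `x`
lies in `D(L)` and `L x = z` if and only if `(S h x - x) / h → z` as `h → 0+`. -/
def IsGenerator (L : H →ₗ.[𝕜] H) (S : ℝ → H →L[𝕜] H) : Prop :=
  ∀ x z : H, (x, z) ∈ L.graph ↔
    Tendsto (fun h : ℝ => ((h : 𝕜)⁻¹) • (S h x - x)) (𝓝[>] 0) (𝓝 z)

/-- The Galerkin operator `Π_K L Π_K : H → K ⊂ H` of a finite-dimensional subspace `K ⊂ D(L)`, where
`Π_K` is the orthogonal projector onto `K`. (A linear map defined on the finite-dimensional space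
`K` is continuous.) -/
noncomputable def galerkinOp (L : H →ₗ.[𝕜] H) (K : Submodule 𝕜 H) [FiniteDimensional 𝕜 K]
    (hK : K ≤ L.domain) : H →L[𝕜] H :=
  K.starProjection.comp
    ((LinearMap.toContinuousLinearMap (L.toFun.comp (Submodule.inclusion hK))).comp
      K.orthogonalProjectionOnto)

/-- Uniform stability of the Galerkin linear flows: for each `N`, the linear flow `e^{L_N t}` on
`H_N` extends to a `C₀`-semigroup `T_N` on `H`, with `‖T_N t‖ ≤ M e^{ω t}`. -/
def GalerkinStability (L : H →ₗ.[𝕜] H) (HN : ℕ → Submodule 𝕜 H)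
    [∀ N, FiniteDimensional 𝕜 (HN N)] (hD : ∀ N, HN N ≤ L.domain) (M ω : ℝ) : Prop :=
  ∃ TN : ℕ → ℝ → H →L[𝕜] H, ∀ N, IsC0Semigroup (TN N) ∧
    (∀ t : ℝ, 0 ≤ t → ∀ v ∈ HN N,
      TN N t v = NormedSpace.exp ((t : 𝕜) • galerkinOp L (HN N) (hD N)) v) ∧
    ∀ t : ℝ, 0 ≤ t → ‖TN N t‖ ≤ M * Real.exp (ω * t)

/-- Consistency of the Galerkin operators: `‖L_N φ - L φ‖ → 0` for every `φ` in `D(L)`. -/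
def GalerkinConsistency (L : H →ₗ.[𝕜] H) (HN : ℕ → Submodule 𝕜 H)
    [∀ N, FiniteDimensional 𝕜 (HN N)] (hD : ∀ N, HN N ≤ L.domain) : Prop :=
  ∀ φ : L.domain,
    Tendsto (fun N => ‖galerkinOp L (HN N) (hD N) (φ : H) - L φ‖) atTop (𝓝 0)

end Semigroups

/-- Locally Lipschitz in the sense of being Lipschitz on every ball centred at the origin. -/
def LipschitzOnBalls {W₁ W₂ : Type*} [NormedAddCommGroup W₁] [NormedAddCommGroup W₂]
    (f : W₁ → W₂) : Prop :=
  ∀ r : ℝ, 0 < r → ∃ K : ℝ, 0 < K ∧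
    ∀ y₁ ∈ Metric.closedBall (0 : W₁) r, ∀ y₂ ∈ Metric.closedBall (0 : W₁) r,
      ‖f y₁ - f y₂‖ ≤ K * ‖y₁ - y₂‖

/-- The set of admissible controls on `[0, T]`: the `u ∈ L^q(0,T;V)` with `u(s) ∈ U` for almost
every `s ∈ [0, T]`. -/
def admissibleControls {V : Type*} [NormedAddCommGroup V] (q : ℝ≥0∞) (U : Set V) (T : ℝ) :
    Set (Lp V q (volume.restrict (Icc (0 : ℝ) T))) :=
  {u | ∀ᵐ s ∂(volume.restrict (Icc (0 : ℝ) T)), u s ∈ U}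

section Solutions

variable {𝕜 H V : Type*} [RCLike 𝕜]
  [NormedAddCommGroup H] [InnerProductSpace 𝕜 H] [NormedSpace ℝ H]

/-- `y` is a mild solution in `C([0,T],H)` of `y' = L y + F(y) + C(u(t))`, `y(0) = x`, where `S` is
the semigroup generated by `L`. Only the values of `y` on `[0, T]` matter. -/
structure IsMildSolution (S : ℝ → H →L[𝕜] H) (F : H → H) (C : V → H) (T : ℝ) (x : H)
    (u : ℝ → V) (y : ℝ → H) : Prop where
  continuousOn : ContinuousOn y (Icc 0 T)
  integrable_F : ∀ t ∈ Icc 0 T, IntervalIntegrable (fun s => S (t - s) (F (y s))) volume 0 t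
  integrable_C : ∀ t ∈ Icc 0 T, IntervalIntegrable (fun s => S (t - s) (C (u s))) volume 0 t
  eq : ∀ t ∈ Icc 0 T,
    y t = S t x + (∫ s in (0 : ℝ)..t, S (t - s) (F (y s))) + ∫ s in (0 : ℝ)..t, S (t - s) (C (u s))

/-- `y` is a solution in `C([0,T],H)`, in the Carathéodory sense, of the Galerkin approximation
`y' = L_K y + Π_K F(y) + Π_K C(u(t))`, `y(0) = Π_K x`, of the evolution problem in the
finite-dimensional subspace `K`. The control `u` being only measurable in time, the differential
equation is understood in its integrated form. Such a `y` is `K`-valued on `[0, T]`. -/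
structure IsGalerkinSolution (L : H →ₗ.[𝕜] H) (K : Submodule 𝕜 H) [FiniteDimensional 𝕜 K]
    (hK : K ≤ L.domain) (F : H → H) (C : V → H) (T : ℝ) (x : H)
    (u : ℝ → V) (y : ℝ → H) : Prop where
  continuousOn : ContinuousOn y (Icc 0 T)
  integrable : IntervalIntegrable (fun s => galerkinOp L K hK (y s) + K.starProjection (F (y s))
    + K.starProjection (C (u s))) volume 0 T
  eq : ∀ t ∈ Icc 0 T, y t = K.starProjection x +
    ∫ s in (0 : ℝ)..t, (galerkinOp L K hK (y s) + K.starProjection (F (y s))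
      + K.starProjection (C (u s)))

variable [NormedAddCommGroup V]

/-- Well-posedness and a priori bounds: for all `T > 0`, `x` and all admissible `u`, there is a
unique mild solution `y(·;x,u)` on `[0,T]` and, for each `N`, a unique Galerkin solution
`y_N(·;Π_N x,u)`; all of these are bounded on `[0,T]` by a constant depending only on `T`, `x`. -/
def UniformWellPosedness (L : H →ₗ.[𝕜] H) (S : ℝ → H →L[𝕜] H) (HN : ℕ → Submodule 𝕜 H)
    [∀ N, FiniteDimensional 𝕜 (HN N)] (hD : ∀ N, HN N ≤ L.domain) (F : H → H) (C : V → H)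
    (q : ℝ≥0∞) (U : Set V) : Prop :=
  ∀ T : ℝ, 0 < T → ∀ x : H,
    (∀ u ∈ admissibleControls q U T,
      (∃ y, IsMildSolution S F C T x u y ∧
        ∀ y', IsMildSolution S F C T x u y' → EqOn y' y (Icc 0 T)) ∧
      ∀ N, ∃ y, IsGalerkinSolution L (HN N) (hD N) F C T x u y ∧
        ∀ y', IsGalerkinSolution L (HN N) (hD N) F C T x u y' → EqOn y' y (Icc 0 T)) ∧
    ∃ B : ℝ, ∀ u ∈ admissibleControls q U T,
      (∀ y, IsMildSolution S F C T x u y → ∀ t ∈ Icc 0 T, ‖y t‖ ≤ B) ∧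
      ∀ N, ∀ y, IsGalerkinSolution L (HN N) (hD N) F C T x u y → ∀ t ∈ Icc 0 T, ‖y t‖ ≤ B

/-- Uniform decay of the residual energy: for all `T > 0` and `x`, the mild solutions satisfy
`sup_{u ∈ U_ad} sup_{t ∈ [0,T]} ‖(Id - Π_N) y(t;x,u)‖ → 0` as `N → ∞`. -/
def UniformResidualDecay (S : ℝ → H →L[𝕜] H) (HN : ℕ → Submodule 𝕜 H)
    [∀ N, FiniteDimensional 𝕜 (HN N)] (F : H → H) (C : V → H) (q : ℝ≥0∞) (U : Set V) : Prop :=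
  ∀ T : ℝ, 0 < T → ∀ x : H,
    ∀ y : Lp V q (volume.restrict (Icc (0 : ℝ) T)) → ℝ → H,
      (∀ u ∈ admissibleControls q U T, IsMildSolution S F C T x u (y u)) →
      Tendsto (fun N => ⨆ u ∈ admissibleControls q U T, ⨆ t ∈ Icc (0 : ℝ) T,
        ‖y u t - (HN N).starProjection (y u t)‖ₑ) atTop (𝓝 0)

end Solutions

/-!
Write `A_N` for the Galerkin operator, `Π_N` for the projector, and `E_N(t) = e^{t A_N} Π_N`. By
variation of constants (`variation_of_constants`) the Galerkin solution is a mild solution for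
`E_N`, so its difference `r` from the mild solution `y` is the sum of

* `(E_N(t) - S(t)) x`, `∫₀ᵗ (E_N(t-s) - S(t-s)) F(y(s)) ds` and
  `∫₀ᵗ (E_N(t-s) - S(t-s)) C(u(s)) ds`, which only involve the linear flows, and
* `∫₀ᵗ E_N(t-s) (F(y_N(s)) - F(y(s))) ds`, whose norm is at most a constant times `∫₀ᵗ ‖r‖`, since
  all the solutions stay in one ball, on which `F` is Lipschitz.

Gronwall's inequality (`IsGalerkinSolution.norm_sub_le`) then reduces the theorem to the convergence
of `E_N(t)` to `S(t)`, uniformly in `t ∈ [0, T]` and over all the vectors `x`, `F(y(s;x,u))` and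
`C(u(s))`, for all controls `u` at once.

These vectors form a totally bounded set: `C(U)` is compact, and the decay of the residuals says
that the values of the mild solutions are uniformly close to bounded sets of finite-dimensional
spaces (`totallyBounded_of_starProjection_close`), a property that the Lipschitz map `F` preserves.
As the `E_N(t)` are uniformly bounded on `[0, T]`, convergence on a dense set of vectors, uniform in
`t`, implies uniform convergence on totally bounded sets
(`eventually_norm_apply_lt_of_totallyBounded`).

It remains to treat initial data in the domain of `L`, which is dense because it contains all the
Galerkin spaces. This is the Trotter–Kato theorem. For `φ ∈ D(L)` Duhamel's formula
(`IsGenerator.projection_apply_sub_exp_eq_integral`) expresses `Π_N S(t) φ - E_N(t) φ` by the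
integral of `E_N(t-s) (L - A_N) S(s) φ`. The integrand tends to zero pointwise by consistency. It is
dominated because the `A_N` are uniformly bounded for the graph norm, by the Banach–Steinhaus
theorem on the graph of `L` (`IsGenerator.exists_norm_le_mul_graph_norm`), which is complete since
generators are closed (`IsGenerator.isClosed_graph`).
-/

/-! ### Primitives of continuous functions and Gronwall's inequality in integral form -/

section Primitives

theorem ContinuousOn.intervalIntegrable_left {E : Type*} [NormedAddCommGroup E] {f : ℝ → E}
    {T t : ℝ}
    (hf : ContinuousOn f (Icc 0 T)) (ht : t ∈ Icc 0 T) : IntervalIntegrable f volume 0 t :=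
  (hf.mono (by rw [uIcc_of_le ht.1]; exact Icc_subset_Icc le_rfl ht.2)).intervalIntegrable

variable {E : Type*} [NormedAddCommGroup E] [NormedSpace ℝ E]

theorem ContinuousOn.hasDerivAt_primitive [CompleteSpace E] {f : ℝ → E} {T s : ℝ}
    (hf : ContinuousOn f (Icc 0 T)) (hs : s ∈ Ioo 0 T) :
    HasDerivAt (fun t => ∫ r in (0 : ℝ)..t, f r) (f s) s :=
  intervalIntegral.integral_hasDerivAt_right
    (hf.intervalIntegrable_left (Ioo_subset_Icc_self hs))
    ((hf.mono Ioo_subset_Icc_self).stronglyMeasurableAtFilter isOpen_Ioo s hs)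
    (hf.continuousAt (Icc_mem_nhds hs.1 hs.2))

theorem IntervalIntegrable.continuousOn_primitive {f : ℝ → E} {T : ℝ} (hT : 0 ≤ T)
    (hf : IntervalIntegrable f volume 0 T) :
    ContinuousOn (fun t => ∫ r in (0 : ℝ)..t, f r) (Icc 0 T) := by
  have h := intervalIntegral.continuousOn_primitive_interval' hf left_mem_uIcc
  rwa [uIcc_of_le hT] at h

/-- Gronwall's inequality in integral form. -/
theorem le_mul_exp_of_le_add_integral {f : ℝ → ℝ} {δ K T : ℝ} (hK : 0 ≤ K)
    (hf : ContinuousOn f (Icc 0 T))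
    (h : ∀ t ∈ Icc 0 T, f t ≤ δ + K * ∫ s in (0 : ℝ)..t, f s) :
    ∀ t ∈ Icc 0 T, f t ≤ δ * Real.exp (K * t) := by
  intro t ht
  have hT : 0 ≤ T := ht.1.trans ht.2
  -- The right-hand side of the hypothesis satisfies the differential inequality `g' ≤ K g`.
  have key := le_gronwallBound_of_liminf_deriv_right_le (a := 0) (b := T) (δ := δ) (K := K)
    (ε := 0) (f := fun t => δ + K * ∫ s in (0 : ℝ)..t, f s) (f' := fun t => K * f t)
    (continuousOn_const.add (continuousOn_const.mul
      (IntervalIntegrable.continuousOn_primitive hT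
        (hf.intervalIntegrable_left ⟨hT, le_rfl⟩))))
    (fun s hs r hr => by
      have hd : HasDerivWithinAt (fun t => ∫ r in (0 : ℝ)..t, f r) (f s) (Ici s) s := by
        have hn : Icc 0 T ∈ 𝓝[>] s := by
          refine mem_of_superset (Ioc_mem_nhdsGT hs.2) fun z hz => ⟨hs.1.trans hz.1.le, hz.2⟩
        refine intervalIntegral.integral_hasDerivWithinAt_right
          (hf.intervalIntegrable_left ⟨hs.1, hs.2.le⟩) ?_ ?_ (t := Ioi s)
        · exact ⟨Icc 0 T, hn, hf.aestronglyMeasurable measurableSet_Icc⟩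
        · exact (hf s ⟨hs.1, hs.2.le⟩).mono_of_mem_nhdsWithin hn
      have hd' := ((hd.const_mul K).const_add δ).liminf_right_slope_le hr
      simpa [slope_def_field, div_eq_inv_mul] using hd')
    (by simp) (fun s hs => by
      have := mul_le_mul_of_nonneg_left (h s ⟨hs.1, hs.2.le⟩) hK
      simpa using this) t ht
  have h1 := (h t ht).trans key
  simpa [gronwallBound_ε0] using h1

end Primitives

/-! ### Exponentials of bounded operators and variation of constants -/

theorem integrable_clm_apply_of_bound {𝕜 H X : Type*} [NontriviallyNormedField 𝕜]
    [NormedAddCommGroup H] [NormedSpace 𝕜 H] [MeasurableSpace X] {μ : Measure X}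
    {B : X → H →L[𝕜] H} {f : X → H} {c : ℝ} (hf : Integrable f μ) (hB : AEStronglyMeasurable B μ)
    (hc : ∀ᵐ x ∂μ, ‖B x‖ ≤ c) : Integrable (fun x => B x (f x)) μ := by
  refine (hf.norm.const_mul c).mono'
    ((ContinuousLinearMap.id 𝕜 (H →L[𝕜] H)).aestronglyMeasurable_comp₂ hB
      hf.aestronglyMeasurable) ?_
  filter_upwards [hc] with x hx
  exact (B x).le_of_opNorm_le hx (f x)

section BoundedExponential

variable {𝕜 H : Type*} [RCLike 𝕜] [NormedAddCommGroup H] [NormedSpace 𝕜 H] [CompleteSpace H]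

theorem continuous_exp_ofReal_smul (A : H →L[𝕜] H) :
    Continuous fun t : ℝ => NormedSpace.exp ((t : 𝕜) • A) :=
  (continuous_iff_continuousAt.2 fun s =>
    (hasDerivAt_exp_smul_const (𝕂 := 𝕜) A s).continuousAt).comp RCLike.continuous_ofReal

theorem continuousOn_exp_sub_smul_apply (A : H →L[𝕜] H) {w : ℝ → H} {I : Set ℝ}
    (hw : ContinuousOn w I) (t : ℝ) :
    ContinuousOn (fun s : ℝ => NormedSpace.exp (((t - s : ℝ) : 𝕜) • A) (w s)) I :=
  ((continuous_exp_ofReal_smul A).comp (continuous_const.sub continuous_id)).continuousOn.clm_apply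
    hw

theorem exists_norm_exp_sub_smul_le (A : H →L[𝕜] H) (t : ℝ) :
    ∃ c : ℝ, ∀ s ∈ Icc 0 t, ‖NormedSpace.exp (((t - s : ℝ) : 𝕜) • A)‖ ≤ c :=
  isCompact_Icc.exists_bound_of_continuousOn
    ((continuous_exp_ofReal_smul A).comp (continuous_const.sub continuous_id)).continuousOn

theorem intervalIntegrable_exp_sub_smul_apply (A : H →L[𝕜] H) {f : ℝ → H} {t : ℝ} (ht : 0 ≤ t)
    (hf : IntervalIntegrable f volume 0 t) :
    IntervalIntegrable (fun s : ℝ => NormedSpace.exp (((t - s : ℝ) : 𝕜) • A) (f s))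
      volume 0 t := by
  obtain ⟨c, hc⟩ := exists_norm_exp_sub_smul_le A t
  rw [intervalIntegrable_iff_integrableOn_Ioc_of_le ht] at hf ⊢
  refine integrable_clm_apply_of_bound (c := c) hf
    ((continuous_exp_ofReal_smul A).comp
      (continuous_const.sub continuous_id)).aestronglyMeasurable ?_
  filter_upwards [ae_restrict_mem measurableSet_Ioc] with s hs
  exact hc s (Ioc_subset_Icc_self hs)

variable [NormedSpace ℝ H] [IsScalarTower ℝ 𝕜 H]

theorem hasDerivAt_exp_ofReal_smul (A : H →L[𝕜] H) (t : ℝ) :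
    HasDerivAt (fun s : ℝ => NormedSpace.exp ((s : 𝕜) • A))
      (NormedSpace.exp ((t : 𝕜) • A) * A) t := by
  have h1 := hasDerivAt_exp_smul_const (𝕂 := 𝕜) A (t : 𝕜)
  have h3 : HasDerivAt (fun s : ℝ => (s : 𝕜)) 1 t := by
    simpa using (RCLike.ofRealCLM (K := 𝕜)).hasDerivAt (x := t)
  have h4 := HasDerivAt.scomp (𝕜 := ℝ) (𝕜' := 𝕜) (h := fun s : ℝ => (s : 𝕜)) t h1 h3
  rwa [one_smul] at h4

/-- The product rule behind both Duhamel formulas below. -/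
theorem HasDerivAt.exp_sub_smul_apply (A : H →L[𝕜] H) {w : ℝ → H} {w' : H} {s : ℝ}
    (hw : HasDerivAt w w' s) (t : ℝ) :
    HasDerivAt (fun s : ℝ => NormedSpace.exp (((t - s : ℝ) : 𝕜) • A) (w s))
      (NormedSpace.exp (((t - s : ℝ) : 𝕜) • A) (w' - A (w s))) s := by
  have h1 := (hasDerivAt_exp_ofReal_smul A (t - s)).scomp s ((hasDerivAt_id s).const_sub t)
  have h2 := (ContinuousLinearMap.restrictScalarsL 𝕜 H H ℝ ℝ).hasFDerivAt.comp_hasDerivAt s h1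
  have h3 : HasDerivAt (fun s : ℝ => NormedSpace.exp (((t - s : ℝ) : 𝕜) • A) (w s))
      (((-1 : ℝ) • (NormedSpace.exp (((t - s : ℝ) : 𝕜) • A) * A)) (w s)
        + NormedSpace.exp (((t - s : ℝ) : 𝕜) • A) w') s := h2.clm_apply hw
  convert h3 using 1
  rw [neg_one_smul, map_sub, sub_eq_neg_add]
  rfl

/-- Integrating `∫₀ˢ f` against `e^{(t-s)A} A`, the derivative of `-e^{(t-s)A}`, by parts. The
function `f` is only integrable, so the formula is obtained by exchanging the integrals over the
triangle `0 ≤ r ≤ s ≤ t`. -/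
theorem integral_exp_sub_smul_primitive (A : H →L[𝕜] H) {f : ℝ → H} {t : ℝ} (ht : 0 ≤ t)
    (hf : IntervalIntegrable f volume 0 t) :
    ∫ s in (0 : ℝ)..t, NormedSpace.exp (((t - s : ℝ) : 𝕜) • A) (A (∫ r in (0 : ℝ)..s, f r)) =
      (∫ s in (0 : ℝ)..t, NormedSpace.exp (((t - s : ℝ) : 𝕜) • A) (f s))
        - ∫ s in (0 : ℝ)..t, f s := by
  have hfi := (intervalIntegrable_iff_integrableOn_Ioc_of_le ht).1 hf
  set μ := (volume : Measure ℝ).restrict (Ioc 0 t) with hμ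
  set E : ℝ → H →L[𝕜] H := fun s => NormedSpace.exp (((t - s : ℝ) : 𝕜) • A) with hE
  have hEc : Continuous E :=
    (continuous_exp_ofReal_smul A).comp (continuous_const.sub continuous_id)
  set k : ℝ → ℝ → H := fun s r =>
    {z : ℝ × ℝ | z.2 ≤ z.1}.indicator (fun z => E z.1 (A (f z.2))) (s, r) with hk
  have hint : Integrable (Function.uncurry k) (μ.prod μ) := by
    obtain ⟨c, hc⟩ := exists_norm_exp_sub_smul_le A t
    refine Integrable.indicator (f := fun z : ℝ × ℝ => E z.1 (A (f z.2))) ?_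
      (measurableSet_le measurable_snd measurable_fst)
    refine integrable_clm_apply_of_bound (c := c) (B := fun z : ℝ × ℝ => E z.1)
      ((A.integrable_comp hfi).comp_snd μ)
      (hEc.comp continuous_fst).aestronglyMeasurable ?_
    have h1 : ∀ᵐ s ∂μ, ‖E s‖ ≤ c := by
      filter_upwards [ae_restrict_mem measurableSet_Ioc] with s hs
      exact hc s (Ioc_subset_Icc_self hs)
    exact Measure.quasiMeasurePreserving_fst.ae h1
  have hswap := integral_integral_swap hint
  have hleft : ∫ s, ∫ r, k s r ∂μ ∂μ = ∫ s in (0 : ℝ)..t, E s (A (∫ r in (0 : ℝ)..s, f r)) := by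
    rw [intervalIntegral.integral_of_le ht]
    refine integral_congr_ae ?_
    filter_upwards [ae_restrict_mem measurableSet_Ioc] with s hs
    have hfs : IntervalIntegrable f volume 0 s := hf.mono_set (by
      rw [uIcc_of_le hs.1.le, uIcc_of_le ht]; exact Icc_subset_Icc le_rfl hs.2)
    have h1 : ∀ r, k s r = (Iic s).indicator (fun r => ((E s).comp A) (f r)) r := fun r => rfl
    simp only [h1]
    rw [integral_indicator measurableSet_Iic, hμ, Measure.restrict_restrict measurableSet_Iic,
      inter_comm, Ioc_inter_Iic, min_eq_right hs.2, ← intervalIntegral.integral_of_le hs.1.le]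
    exact ((E s).comp A).intervalIntegral_comp_comm hfs
  have hright : ∫ r, ∫ s, k s r ∂μ ∂μ = ∫ r in (0 : ℝ)..t, (E r (f r) - f r) := by
    rw [intervalIntegral.integral_of_le ht]
    refine integral_congr_ae ?_
    filter_upwards [ae_restrict_mem measurableSet_Ioc] with r hr
    have h1 : ∀ s, k s r = (Ici r).indicator (fun s => E s (A (f r))) s := fun s => rfl
    have h2 : Ici r ∩ Ioc 0 t = Icc r t := by
      ext s
      exact ⟨fun h => ⟨h.1, h.2.2⟩, fun h => ⟨h.1, hr.1.trans_le h.1, h.2⟩⟩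
    simp only [h1]
    rw [integral_indicator measurableSet_Ici, hμ, Measure.restrict_restrict measurableSet_Ici, h2,
      integral_Icc_eq_integral_Ioc, ← intervalIntegral.integral_of_le hr.2]
    have h3 := intervalIntegral.integral_eq_sub_of_hasDerivAt (a := r) (b := t)
      (f := fun s => -E s (f r)) (f' := fun s => E s (A (f r)))
      (fun s _ => by
        have := ((hasDerivAt_const s (f r)).exp_sub_smul_apply A t).neg
        simpa [hE] using! this)
      (continuousOn_exp_sub_smul_apply A continuousOn_const t).intervalIntegrable
    have hEt : E t = 1 := by simp [hE]
    rw [h3, hEt, one_apply_eq_self, neg_sub_neg]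
  rw [← hleft, hswap, hright, intervalIntegral.integral_sub
    (intervalIntegrable_exp_sub_smul_apply A ht hf) hf]

/-- Variation of constants: the integrated form of `y' = A y + f`, `y(0) = x`, with `A` bounded
and `f` integrable, gives `y(t) = e^{tA} x + ∫₀ᵗ e^{(t-s)A} f(s) ds`. -/
theorem variation_of_constants (A : H →L[𝕜] H) {f y : ℝ → H} {x : H} {t : ℝ} (ht : 0 ≤ t)
    (hy : ContinuousOn y (Icc 0 t)) (hf : IntervalIntegrable f volume 0 t)
    (h : ∀ s ∈ Icc 0 t, y s = x + ∫ r in (0 : ℝ)..s, (A (y r) + f r)) :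
    y t = NormedSpace.exp ((t : 𝕜) • A) x
      + ∫ s in (0 : ℝ)..t, NormedSpace.exp (((t - s : ℝ) : 𝕜) • A) (f s) := by
  have hAy : ContinuousOn (fun s => A (y s)) (Icc 0 t) := A.continuous.comp_continuousOn hy
  -- `w = y - ∫ f` is continuously differentiable with `w' = A y`
  set w : ℝ → H := fun s => x + ∫ r in (0 : ℝ)..s, A (y r) with hw
  have hyw : ∀ s ∈ Icc 0 t, y s = w s + ∫ r in (0 : ℝ)..s, f r := by
    intro s hs
    rw [h s hs, intervalIntegral.integral_add (hAy.intervalIntegrable_left hs)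
      (hf.mono_set (by rw [uIcc_of_le hs.1, uIcc_of_le ht]; exact Icc_subset_Icc le_rfl hs.2))]
    simp [hw, add_assoc]
  have hwc : ContinuousOn w (Icc 0 t) := continuousOn_const.add
    (IntervalIntegrable.continuousOn_primitive ht (hAy.intervalIntegrable_left ⟨ht, le_rfl⟩))
  have hfc := IntervalIntegrable.continuousOn_primitive ht hf
  have key := intervalIntegral.integral_eq_sub_of_hasDerivAt_of_le ht
    (continuousOn_exp_sub_smul_apply A hwc t)
    (f' := fun s => NormedSpace.exp (((t - s : ℝ) : 𝕜) • A) (A (∫ r in (0 : ℝ)..s, f r)))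
    (fun s hs => by
      have h1 := ((hAy.hasDerivAt_primitive hs).const_add x).exp_sub_smul_apply A t
      convert h1 using 2
      rw [hyw s (Ioo_subset_Icc_self hs)]
      simp [hw])
    (ContinuousOn.intervalIntegrable_left
      (continuousOn_exp_sub_smul_apply A (A.continuous.comp_continuousOn hfc) t) ⟨ht, le_rfl⟩)
  rw [integral_exp_sub_smul_primitive A ht hf] at key
  have hw0 : w 0 = x := by simp [hw]
  simp only [sub_self, RCLike.ofReal_zero, zero_smul, NormedSpace.exp_zero, sub_zero, hw0,
    one_apply_eq_self] at key
  rw [hyw t ⟨ht, le_rfl⟩, sub_eq_iff_eq_add.1 key.symm]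
  abel

end BoundedExponential

/-! ### Orbits and generators of `C₀`-semigroups -/

section Semigroup

variable {𝕜 H : Type*} [RCLike 𝕜] [NormedAddCommGroup H] [InnerProductSpace 𝕜 H]
  {S : ℝ → H →L[𝕜] H}

theorem IsC0Semigroup.apply_apply (hS : IsC0Semigroup S) {s t : ℝ} (hs : 0 ≤ s) (ht : 0 ≤ t)
    (x : H) : S s (S t x) = S (s + t) x := by
  rw [hS.map_add s t hs ht]; rfl

theorem IsC0Semigroup.tendsto_nhdsGE (hS : IsC0Semigroup S) (x : H) :
    Tendsto (fun t => S t x) (𝓝[≥] 0) (𝓝 x) := by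
  rw [← Ioi_insert, nhdsWithin_insert, tendsto_sup]
  refine ⟨?_, hS.tendsto_zero x⟩
  have : S 0 x = x := by rw [hS.map_zero]; rfl
  simpa [this] using tendsto_pure_nhds (fun t => S t x) 0

theorem IsC0Semigroup.continuousOn_apply (hS : IsC0Semigroup S)
    (hb : ∀ T, ∃ c, ∀ t ∈ Icc 0 T, ‖S t‖ ≤ c) (x : H) :
    ContinuousOn (fun t => S t x) (Ici 0) := by
  intro t₀ ht₀
  obtain ⟨c, hc⟩ := hb (t₀ + 1)
  have habs : Tendsto (fun t => |t - t₀|) (𝓝[Ici 0] t₀) (𝓝[≥] 0) := by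
    refine tendsto_nhdsWithin_iff.2 ⟨?_, Eventually.of_forall fun t => mem_Ici.2 (abs_nonneg _)⟩
    have : Tendsto (fun t => |t - t₀|) (𝓝 t₀) (𝓝 |t₀ - t₀|) :=
      ((continuous_id.sub continuous_const).abs).tendsto t₀
    simp only [sub_self, abs_zero] at this
    exact this.mono_left inf_le_left
  have hlim : Tendsto (fun t => c * ‖S |t - t₀| x - x‖) (𝓝[Ici 0] t₀) (𝓝 0) := by
    simpa using ((((hS.tendsto_nhdsGE x).comp habs).sub_const x).norm).const_mul c
  have hstep : ∀ s t : ℝ, 0 ≤ s → s ≤ t → t ≤ t₀ + 1 →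
      ‖S t x - S s x‖ ≤ c * ‖S |t - s| x - x‖ := by
    intro s t hs hst ht
    have h1 : S t x - S s x = S s (S |t - s| x - x) := by
      rw [map_sub, hS.apply_apply hs (abs_nonneg _), abs_of_nonneg (sub_nonneg.2 hst),
        add_sub_cancel]
    rw [h1]
    exact (S s).le_of_opNorm_le (hc s ⟨hs, hst.trans ht⟩) _
  refine tendsto_iff_norm_sub_tendsto_zero.2 (squeeze_zero' (Eventually.of_forall fun _ =>
    norm_nonneg _) ?_ hlim)
  filter_upwards [self_mem_nhdsWithin, mem_nhdsWithin_of_mem_nhds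
    (Iic_mem_nhds (lt_add_one t₀))] with t ht ht1
  rcases le_total t t₀ with h | h
  · rw [norm_sub_rev, abs_sub_comm]
    exact hstep t t₀ ht h (by linarith)
  · exact hstep t₀ t ht₀ h ht1

theorem IsC0Semigroup.intervalIntegrable_apply (hS : IsC0Semigroup S)
    (hb : ∀ T, ∃ c, ∀ t ∈ Icc 0 T, ‖S t‖ ≤ c) (x : H) {t : ℝ} (ht : 0 ≤ t) :
    IntervalIntegrable (fun s => S s x) volume 0 t :=
  ((hS.continuousOn_apply hb x).mono Icc_subset_Ici_self).intervalIntegrable_left ⟨ht, le_rfl⟩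

/-- The domain of the generator is invariant under the semigroup, which commutes with the
generator there. -/
theorem IsGenerator.map_mem_graph {L : H →ₗ.[𝕜] H} (hLS : IsGenerator L S)
    (hS : IsC0Semigroup S) {x z : H} (h : (x, z) ∈ L.graph) {t : ℝ} (ht : 0 ≤ t) :
    (S t x, S t z) ∈ L.graph := by
  rw [hLS] at h ⊢
  refine (((S t).continuous.tendsto z).comp h).congr' ?_
  filter_upwards [self_mem_nhdsWithin] with s hs
  have hs' : (0 : ℝ) ≤ s := (mem_Ioi.1 hs).le
  simp only [Function.comp, map_smul, map_sub, hS.apply_apply ht hs', hS.apply_apply hs' ht,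
    add_comm]

variable [CompleteSpace H] [NormedSpace ℝ H] [IsScalarTower ℝ 𝕜 H]

/-- A pair `(x, z)` belongs to the graph of the generator if and only if
`S t x - x = ∫₀ᵗ S s z ds` for all `t ≥ 0`. -/
theorem IsGenerator.mem_graph_iff_integral {L : H →ₗ.[𝕜] H} (hLS : IsGenerator L S)
    (hS : IsC0Semigroup S) (hb : ∀ T, ∃ c, ∀ t ∈ Icc 0 T, ‖S t‖ ≤ c) {x z : H} :
    (x, z) ∈ L.graph ↔ ∀ t : ℝ, 0 ≤ t → S t x - x = ∫ s in (0 : ℝ)..t, S s z := by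
  have h0 : ∀ v, S 0 v = v := fun v => by rw [hS.map_zero]; rfl
  constructor
  · intro h t ht
    have key := intervalIntegral.integral_eq_sub_of_hasDeriv_right_of_le ht
      ((hS.continuousOn_apply hb x).mono Icc_subset_Ici_self) (f' := fun s => S s z)
      (fun s hs => by
        rw [hasDerivWithinAt_iff_tendsto_slope' self_notMem_Ioi]
        have h1 := ((S s).continuous.tendsto z).comp ((hLS x z).1 h)
        have h2 : Tendsto (fun r => r - s) (𝓝[>] s) (𝓝[>] 0) := by
          refine tendsto_nhdsWithin_iff.2 ⟨?_, ?_⟩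
          · have : Tendsto (fun r => r - s) (𝓝 s) (𝓝 (s - s)) :=
              (continuous_id.sub continuous_const).tendsto s
            rw [sub_self] at this
            exact this.mono_left inf_le_left
          · filter_upwards [self_mem_nhdsWithin] with r hr using sub_pos.2 (mem_Ioi.1 hr)
        refine (h1.comp h2).congr' ?_
        filter_upwards [self_mem_nhdsWithin] with r hr
        have hr' : (0 : ℝ) ≤ r - s := (sub_pos.2 hr).le
        rw [slope_def_module, RCLike.real_smul_eq_coe_smul (K := 𝕜)]
        simp only [Function.comp, map_smul, map_sub, hS.apply_apply hs.1.le hr', add_sub_cancel,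
          RCLike.ofReal_inv])
      (hS.intervalIntegrable_apply hb z ht)
    rw [key, h0]
  · intro h
    rw [hLS]
    have h1 : HasDerivWithinAt (fun t => ∫ s in (0 : ℝ)..t, S s z) (S 0 z) (Ici 0) 0 := by
      refine intervalIntegral.integral_hasDerivWithinAt_right (t := Ioi 0) (by simp) ?_ ?_
      · exact ⟨Ici 0, mem_of_superset self_mem_nhdsWithin Ioi_subset_Ici_self,
          (hS.continuousOn_apply hb z).aestronglyMeasurable measurableSet_Ici⟩
      · exact (hS.continuousOn_apply hb z 0 self_mem_Ici).mono Ioi_subset_Ici_self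
    have h2 := (hasDerivWithinAt_iff_tendsto_slope' self_notMem_Ioi).1
      (h1.mono Ioi_subset_Ici_self)
    rw [h0] at h2
    refine h2.congr' ?_
    filter_upwards [self_mem_nhdsWithin] with t ht
    rw [slope_def_module, RCLike.real_smul_eq_coe_smul (K := 𝕜), ← h t (mem_Ioi.1 ht).le]
    simp

theorem IsGenerator.isClosed_graph {L : H →ₗ.[𝕜] H} (hLS : IsGenerator L S)
    (hS : IsC0Semigroup S) (hb : ∀ T, ∃ c, ∀ t ∈ Icc 0 T, ‖S t‖ ≤ c) :
    IsClosed (L.graph : Set (H × H)) := by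
  have hset : (L.graph : Set (H × H)) =
      ⋂ t : ℝ, ⋂ _ : 0 ≤ t, {p | S t p.1 - p.1 = ∫ s in (0 : ℝ)..t, S s p.2} := by
    ext ⟨x, z⟩
    simp only [SetLike.mem_coe, hLS.mem_graph_iff_integral hS hb, mem_iInter, mem_ofPred_eq]
  rw [hset]
  refine isClosed_iInter fun t => isClosed_iInter fun ht => isClosed_eq
    (((S t).continuous.comp continuous_fst).sub continuous_fst) ?_
  obtain ⟨c, hc⟩ := hb t
  have hlip : LipschitzWith (c * t).toNNReal fun z => ∫ s in (0 : ℝ)..t, S s z := by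
    refine LipschitzWith.of_dist_le' fun z z' => ?_
    rw [dist_eq_norm, dist_eq_norm, ← intervalIntegral.integral_sub
      (hS.intervalIntegrable_apply hb z ht) (hS.intervalIntegrable_apply hb z' ht)]
    have := intervalIntegral.norm_integral_le_of_norm_le_const (a := 0) (b := t)
      (f := fun s => S s z - S s z') (C := c * ‖z - z'‖) (fun s hs => by
        rw [uIoc_of_le ht] at hs
        rw [← map_sub]
        exact (S s).le_of_opNorm_le (hc s (Ioc_subset_Icc_self hs)) _)
    rw [sub_zero, abs_of_nonneg ht] at this
    linarith
  exact hlip.continuous.comp continuous_snd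

end Semigroup

/-! ### Uniformly bounded families of operators that converge pointwise -/

section Equicontinuity

variable {𝕜 H ι : Type*} [NontriviallyNormedField 𝕜] [NormedAddCommGroup H] [NormedSpace 𝕜 H]
  {B : ℕ → ι → H →L[𝕜] H} {I : Set ι} {c : ℝ}

/-- A uniformly bounded family of operators that tends to zero at each point of a set `D`, uniformly
over the parameters in `I`, does so uniformly on each totally bounded subset of the closure
of `D`. -/
theorem eventually_norm_apply_lt_of_totallyBounded (hB : ∀ N, ∀ i ∈ I, ‖B N i‖ ≤ c) {D K : Set H}
    (hD : ∀ x ∈ D, ∀ ε > 0, ∀ᶠ N in atTop, ∀ i ∈ I, ‖B N i x‖ < ε) (hK : TotallyBounded K)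
    (hKD : K ⊆ closure D) {ε : ℝ} (hε : 0 < ε) :
    ∀ᶠ N in atTop, ∀ i ∈ I, ∀ x ∈ K, ‖B N i x‖ < ε := by
  obtain ⟨δ, hδ, hcδ⟩ : ∃ δ > 0, |c| * δ + |c| * δ < ε / 2 := by
    refine ⟨ε / (8 * (|c| + 1)), by positivity, ?_⟩
    have hc : |c| / (|c| + 1) < 1 := by rw [div_lt_one (by positivity)]; linarith
    have h1 : |c| * (ε / (8 * (|c| + 1))) = |c| / (|c| + 1) * (ε / 8) := by field_simp
    rw [h1]
    nlinarith
  obtain ⟨t, htK, htf, hcov⟩ := Metric.finite_approx_of_totallyBounded hK δ hδ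
  have hnear : ∀ z ∈ t, ∃ x ∈ D, dist z x < δ := fun z hz =>
    Metric.mem_closure_iff.1 (hKD (htK hz)) δ hδ
  choose! p hpD hp using hnear
  have hev := (htf.eventually_all (l := atTop)
    (p := fun z N => ∀ i ∈ I, ‖B N i (p z)‖ < ε / 2)).2
    fun z hz => hD (p z) (hpD z hz) (ε / 2) (half_pos hε)
  filter_upwards [hev] with N hN i hi x hx
  obtain ⟨z, hz, hxz⟩ := mem_iUnion₂.1 (hcov hx)
  have hBb : ∀ v, ‖v‖ ≤ δ → ‖B N i v‖ ≤ |c| * δ := fun v hv =>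
    ((B N i).le_of_opNorm_le ((hB N i hi).trans (le_abs_self c)) v).trans
      (mul_le_mul_of_nonneg_left hv (abs_nonneg c))
  have h1 := hBb (x - z) (by rw [← dist_eq_norm]; exact (Metric.mem_ball.1 hxz).le)
  have h2 := hBb (z - p z) (by rw [← dist_eq_norm]; exact (hp z hz).le)
  have h3 := hN z hz i hi
  have h4 : B N i x = B N i (x - z) + B N i (z - p z) + B N i (p z) := by
    simp only [map_sub]; abel
  rw [h4]
  linarith [norm_add₃_le (a := B N i (x - z)) (b := B N i (z - p z)) (c := B N i (p z))]

end Equicontinuity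

/-! ### The Trotter–Kato approximation theorem -/

/-- Dominated convergence for integrals of norms along an orbit. -/
theorem tendsto_integral_norm_of_dominated {E : Type*} [NormedAddCommGroup E] {T : ℝ}
    {f : ℕ → ℝ → E} {C : ℝ}
    (hf : ∀ N, ContinuousOn (f N) (Icc 0 T)) (hT : 0 ≤ T)
    (hC : ∀ N, ∀ s ∈ Icc 0 T, ‖f N s‖ ≤ C)
    (hlim : ∀ s ∈ Icc 0 T, Tendsto (fun N => f N s) atTop (𝓝 0)) :
    Tendsto (fun N => ∫ s in (0 : ℝ)..T, ‖f N s‖) atTop (𝓝 0) := by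
  have h := intervalIntegral.tendsto_integral_filter_of_dominated_convergence
    (μ := volume) (a := 0) (b := T) (F := fun N s => ‖f N s‖) (f := fun _ => 0) (l := atTop)
    (fun _ => C)
    (Eventually.of_forall fun N => by
      rw [uIoc_of_le hT]
      exact ((hf N).norm.mono Ioc_subset_Icc_self).aestronglyMeasurable measurableSet_Ioc)
    (Eventually.of_forall fun N => Eventually.of_forall fun s hs => by
      rw [uIoc_of_le hT] at hs
      simpa using hC N s (Ioc_subset_Icc_self hs))
    intervalIntegrable_const
    (Eventually.of_forall fun s hs => by
      rw [uIoc_of_le hT] at hs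
      simpa using (hlim s (Ioc_subset_Icc_self hs)).norm)
  simpa using h

theorem integral_norm_le_of_mem_Icc {E : Type*} [NormedAddCommGroup E] {T : ℝ}
    {f : ℝ → E} (hf : ContinuousOn f (Icc 0 T)) {t : ℝ}
    (ht : t ∈ Icc 0 T) : ∫ s in (0 : ℝ)..t, ‖f s‖ ≤ ∫ s in (0 : ℝ)..T, ‖f s‖ :=
  intervalIntegral.integral_mono_interval le_rfl ht.1 ht.2
    (Eventually.of_forall fun _ => norm_nonneg _)
    (hf.norm.intervalIntegrable_left ⟨ht.1.trans ht.2, le_rfl⟩)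

section TrotterKato

variable {𝕜 H : Type*} [RCLike 𝕜] [NormedAddCommGroup H] [InnerProductSpace 𝕜 H]
  [CompleteSpace H] [NormedSpace ℝ H] [IsScalarTower ℝ 𝕜 H]
  {S : ℝ → H →L[𝕜] H} {L : H →ₗ.[𝕜] H} {A P : ℕ → H →L[𝕜] H} {c T : ℝ}

/-- Bounded operators that converge pointwise on the domain of a generator are uniformly bounded
for the graph norm: this is the Banach–Steinhaus theorem on the graph, which is complete. -/
theorem IsGenerator.exists_norm_le_mul_graph_norm (hLS : IsGenerator L S) (hS : IsC0Semigroup S)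
    (hb : ∀ T, ∃ c, ∀ t ∈ Icc 0 T, ‖S t‖ ≤ c)
    (hA : ∀ x z, (x, z) ∈ L.graph → Tendsto (fun N => A N x) atTop (𝓝 z)) :
    ∃ C, ∀ N, ∀ p ∈ L.graph, ‖A N p.1‖ ≤ C * ‖p‖ := by
  have : CompleteSpace L.graph := (hLS.isClosed_graph hS hb).completeSpace_coe
  obtain ⟨C, hC⟩ := banach_steinhaus
    (g := fun N => (A N).comp ((ContinuousLinearMap.fst 𝕜 H H).comp L.graph.subtypeL))
    (fun p => by
      obtain ⟨b, hb⟩ := (hA p.1.1 p.1.2 p.2).norm.bddAbove_range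
      exact ⟨b, fun N => hb ⟨N, rfl⟩⟩)
  exact ⟨C, fun N p hp => ContinuousLinearMap.le_of_opNorm_le _ (hC N) (⟨p, hp⟩ : L.graph)⟩

/-- Duhamel's formula for the difference of the flow of `L` and the flow of a bounded operator. -/
theorem IsGenerator.projection_apply_sub_exp_eq_integral (hLS : IsGenerator L S)
    (hS : IsC0Semigroup S) (hb : ∀ T, ∃ c, ∀ t ∈ Icc 0 T, ‖S t‖ ≤ c) {A P : H →L[𝕜] H}
    (hAP : ∀ v, A (P v) = A v) (hPA : ∀ v, P (A v) = A v) {x z : H} (h : (x, z) ∈ L.graph) {t : ℝ}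
    (ht : 0 ≤ t) :
    P (S t x) - NormedSpace.exp ((t : 𝕜) • A) (P x) =
      ∫ s in (0 : ℝ)..t, NormedSpace.exp (((t - s : ℝ) : 𝕜) • A) (P (S s z - A (S s x))) := by
  have hx := (hS.continuousOn_apply hb x).mono (Icc_subset_Ici_self (a := t) (b := 0))
  have hz := (hS.continuousOn_apply hb z).mono (Icc_subset_Ici_self (a := t) (b := 0))
  have key := intervalIntegral.integral_eq_sub_of_hasDerivAt_of_le ht
    (continuousOn_exp_sub_smul_apply A (P.continuous.comp_continuousOn hx) t)
    (f' := fun s => NormedSpace.exp (((t - s : ℝ) : 𝕜) • A) (P (S s z - A (S s x))))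
    (fun s hs => by
      have h1 : HasDerivAt (fun s => S s x) (S s z) s := by
        refine ((hz.hasDerivAt_primitive hs).const_add x).congr_of_eventuallyEq ?_
        filter_upwards [Ioi_mem_nhds hs.1] with r hr
        rw [← (hLS.mem_graph_iff_integral hS hb).1 h r (mem_Ioi.1 hr).le, add_sub_cancel]
      have h2 : HasDerivAt (fun s => P (S s x)) (P (S s z)) s :=
        (P.restrictScalars ℝ).hasFDerivAt.comp_hasDerivAt s h1
      have h3 := h2.exp_sub_smul_apply A t
      rwa [hAP, ← hPA, ← map_sub P] at h3)
    (ContinuousOn.intervalIntegrable_left (continuousOn_exp_sub_smul_apply A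
      (P.continuous.comp_continuousOn (hz.sub (A.continuous.comp_continuousOn hx))) t)
      ⟨ht, le_rfl⟩)
  have h0 : S 0 x = x := by rw [hS.map_zero]; rfl
  rw [key]
  simp [NormedSpace.exp_zero, h0]

/-- The Trotter–Kato theorem on the domain of the generator, uniformly on `[0, T]`. -/
theorem IsGenerator.eventually_norm_exp_sub_lt_of_mem_graph (hLS : IsGenerator L S)
    (hS : IsC0Semigroup S) (hb : ∀ T, ∃ c, ∀ t ∈ Icc 0 T, ‖S t‖ ≤ c)
    (hAP : ∀ N v, A N (P N v) = A N v) (hPA : ∀ N v, P N (A N v) = A N v)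
    (hP : ∀ x, Tendsto (fun N => P N x) atTop (𝓝 x))
    (hA : ∀ x z, (x, z) ∈ L.graph → Tendsto (fun N => A N x) atTop (𝓝 z)) (hT : 0 ≤ T)
    (hc : ∀ N, ∀ t ∈ Icc 0 T, ∀ v, ‖NormedSpace.exp ((t : 𝕜) • A N) (P N v)‖ ≤ c * ‖v‖)
    {x z : H} (h : (x, z) ∈ L.graph) {ε : ℝ} (hε : 0 < ε) :
    ∀ᶠ N in atTop, ∀ t ∈ Icc 0 T,
      ‖NormedSpace.exp ((t : 𝕜) • A N) (P N x) - S t x‖ < ε := by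
  have hx := (hS.continuousOn_apply hb x).mono (Icc_subset_Ici_self (a := T) (b := 0))
  have hz := (hS.continuousOn_apply hb z).mono (Icc_subset_Ici_self (a := T) (b := 0))
  have hAx : ∀ N, ContinuousOn (fun s => S s z - A N (S s x)) (Icc 0 T) := fun N =>
    hz.sub ((A N).continuous.comp_continuousOn hx)
  have hPz : ∀ N, ContinuousOn (fun s => P N (S s z) - S s z) (Icc 0 T) := fun N =>
    ((P N).continuous.comp_continuousOn hz).sub hz
  have hPc : ∀ N v, ‖P N v‖ ≤ c * ‖v‖ := fun N v => by
    simpa [NormedSpace.exp_zero] using hc N 0 ⟨le_rfl, hT⟩ v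
  obtain ⟨C, hC⟩ := hLS.exists_norm_le_mul_graph_norm hS hb hA
  obtain ⟨bx, hbx⟩ := isCompact_Icc.exists_bound_of_continuousOn hx
  obtain ⟨bz, hbz⟩ := isCompact_Icc.exists_bound_of_continuousOn hz
  have hmem : ∀ s ∈ Icc 0 T, (S s x, S s z) ∈ L.graph := fun s hs => hLS.map_mem_graph hS h hs.1
  have h1 : Tendsto (fun N => ∫ s in (0 : ℝ)..T, ‖S s z - A N (S s x)‖) atTop (𝓝 0) := by
    refine tendsto_integral_norm_of_dominated (C := bz + |C| * max bx bz) hAx hT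
      (fun N s hs => ?_) fun s hs => ?_
    · have h2 : ‖A N (S s x)‖ ≤ |C| * max bx bz :=
        (hC N _ (hmem s hs)).trans (mul_le_mul (le_abs_self C)
          (max_le_max (hbx s hs) (hbz s hs)) (norm_nonneg _) (abs_nonneg C))
      exact (norm_sub_le _ _).trans (add_le_add (hbz s hs) h2)
    · simpa using (hA _ _ (hmem s hs)).const_sub (S s z)
  have h2 : Tendsto (fun N => ∫ s in (0 : ℝ)..T, ‖P N (S s z) - S s z‖) atTop (𝓝 0) := by
    refine tendsto_integral_norm_of_dominated (C := |c| * bz + bz) hPz hT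
      (fun N s hs => ?_) fun s hs => ?_
    · have h3 : ‖P N (S s z)‖ ≤ |c| * bz :=
        (hPc N _).trans (mul_le_mul (le_abs_self c) (hbz s hs) (norm_nonneg _) (abs_nonneg c))
      exact (norm_sub_le _ _).trans (add_le_add h3 (hbz s hs))
    · simpa using (hP (S s z)).sub_const (S s z)
  have h3 : Tendsto (fun N => ‖P N x - x‖) atTop (𝓝 0) := by
    simpa using ((hP x).sub_const x).norm
  have hsum := ((h1.const_mul |c|).add h2).add h3
  simp only [mul_zero, add_zero] at hsum
  filter_upwards [hsum.eventually_lt_const hε] with N hN t ht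
  refine lt_of_le_of_lt ?_ hN
  -- `P S(t) x - S(t) x` is controlled uniformly in `t` by means of `S(t) x = x + ∫ S(s) z`.
  have e1 : P N (S t x) - S t x
      = (P N x - x) + ∫ s in (0 : ℝ)..t, (P N (S s z) - S s z) := by
    have hSt := (hLS.mem_graph_iff_integral hS hb).1 h t ht.1
    have hzi := hS.intervalIntegrable_apply hb z ht.1
    have hPzi : IntervalIntegrable (fun s => P N (S s z)) volume 0 t :=
      ((P N).continuous.comp_continuousOn hz).intervalIntegrable_left ht
    rw [intervalIntegral.integral_sub hPzi hzi,
      (P N).intervalIntegral_comp_comm hzi, ← hSt, map_sub]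
    abel
  have e2 := hLS.projection_apply_sub_exp_eq_integral hS hb (hAP N) (hPA N) h ht.1
  have b1 : ‖∫ s in (0 : ℝ)..t, (P N (S s z) - S s z)‖
      ≤ ∫ s in (0 : ℝ)..T, ‖P N (S s z) - S s z‖ :=
    (intervalIntegral.norm_integral_le_integral_norm ht.1).trans
      (integral_norm_le_of_mem_Icc (hPz N) ht)
  have b2 : ‖P N (S t x) - NormedSpace.exp ((t : 𝕜) • A N) (P N x)‖
      ≤ |c| * ∫ s in (0 : ℝ)..T, ‖S s z - A N (S s x)‖ := by
    rw [e2]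
    refine (intervalIntegral.norm_integral_le_of_norm_le (g := fun s =>
      |c| * ‖S s z - A N (S s x)‖) ht.1 (Eventually.of_forall fun s hs => ?_)
      (((hAx N).norm.intervalIntegrable_left ht).const_mul _)).trans ?_
    · exact (hc N (t - s) ⟨by linarith [hs.2], by linarith [hs.1, ht.2]⟩ _).trans
        (mul_le_mul_of_nonneg_right (le_abs_self c) (norm_nonneg _))
    · rw [intervalIntegral.integral_const_mul]
      exact mul_le_mul_of_nonneg_left (integral_norm_le_of_mem_Icc (hAx N) ht) (abs_nonneg c)
  have e3 : NormedSpace.exp ((t : 𝕜) • A N) (P N x) - S t x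
      = (P N (S t x) - S t x) - (P N (S t x) - NormedSpace.exp ((t : 𝕜) • A N) (P N x)) := by abel
  rw [e3, e1]
  refine (norm_sub_le _ _).trans ?_
  linarith [norm_add_le (P N x - x) (∫ s in (0 : ℝ)..t, (P N (S s z) - S s z))]

/-- The Trotter–Kato theorem, uniformly on `[0, T]` and on totally bounded sets of initial data. -/
theorem IsGenerator.eventually_norm_exp_sub_lt (hLS : IsGenerator L S)
    (hS : IsC0Semigroup S) (hb : ∀ T, ∃ c, ∀ t ∈ Icc 0 T, ‖S t‖ ≤ c)
    (hd : Dense (L.domain : Set H))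
    (hAP : ∀ N v, A N (P N v) = A N v) (hPA : ∀ N v, P N (A N v) = A N v)
    (hP : ∀ x, Tendsto (fun N => P N x) atTop (𝓝 x))
    (hA : ∀ x z, (x, z) ∈ L.graph → Tendsto (fun N => A N x) atTop (𝓝 z)) (hT : 0 ≤ T)
    (hc : ∀ N, ∀ t ∈ Icc 0 T, ∀ v, ‖NormedSpace.exp ((t : 𝕜) • A N) (P N v)‖ ≤ c * ‖v‖)
    {K : Set H} (hK : TotallyBounded K) {ε : ℝ} (hε : 0 < ε) :
    ∀ᶠ N in atTop, ∀ t ∈ Icc 0 T, ∀ x ∈ K,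
      ‖NormedSpace.exp ((t : 𝕜) • A N) (P N x) - S t x‖ < ε := by
  obtain ⟨c', hc'⟩ := hb T
  refine eventually_norm_apply_lt_of_totallyBounded (c := |c| + c') (D := L.domain)
    (B := fun N (t : ℝ) => (NormedSpace.exp ((t : 𝕜) • A N)).comp (P N) - S t)
    (fun N t ht => ?_) (fun x hx ε hε => ?_) hK (fun x _ => hd x) hε
  · refine (norm_sub_le _ _).trans (add_le_add ?_ (hc' t ht))
    exact ContinuousLinearMap.opNorm_le_bound _ (abs_nonneg c) fun v =>
      (hc N t ht v).trans (mul_le_mul_of_nonneg_right (le_abs_self c) (norm_nonneg v))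
  · obtain ⟨z, hz⟩ := LinearPMap.mem_domain_iff.1 hx
    exact hLS.eventually_norm_exp_sub_lt_of_mem_graph hS hb hAP hPA hP hA hT hc hz hε

end TrotterKato

/-! ### Galerkin operators -/

section Galerkin

variable {𝕜 H : Type*} [RCLike 𝕜] [NormedAddCommGroup H] [InnerProductSpace 𝕜 H]
  {L : H →ₗ.[𝕜] H}

theorem starProjection_galerkinOp_apply (K : Submodule 𝕜 H) [FiniteDimensional 𝕜 K]
    (hK : K ≤ L.domain) (v : H) : K.starProjection (galerkinOp L K hK v) = galerkinOp L K hK v :=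
  Submodule.starProjection_eq_self_iff.2 (Submodule.starProjection_apply_mem K _)

theorem galerkinOp_starProjection_apply (K : Submodule 𝕜 H) [FiniteDimensional 𝕜 K]
    (hK : K ≤ L.domain) (v : H) : galerkinOp L K hK (K.starProjection v) = galerkinOp L K hK v := by
  have h : K.orthogonalProjectionOnto (K.starProjection v) = K.orthogonalProjectionOnto v := by
    rw [Submodule.starProjection_apply]
    exact Submodule.orthogonalProjectionOnto_mem_subspace_eq_self _
  simp only [galerkinOp, ContinuousLinearMap.comp_apply, h]

variable {HN : ℕ → Submodule 𝕜 H} [∀ N, FiniteDimensional 𝕜 (HN N)]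
  {hD : ∀ N, HN N ≤ L.domain}

theorem dense_domain_of_tendsto_starProjection (hD : ∀ N, HN N ≤ L.domain)
    (hHN : ∀ x, Tendsto (fun N => (HN N).starProjection x) atTop (𝓝 x)) :
    Dense (L.domain : Set H) := fun x =>
  mem_closure_of_tendsto (hHN x)
    (Eventually.of_forall fun N => hD N (Submodule.starProjection_apply_mem _ x))

theorem GalerkinConsistency.tendsto_of_mem_graph (h : GalerkinConsistency L HN hD) {x z : H}
    (hxz : (x, z) ∈ L.graph) : Tendsto (fun N => galerkinOp L (HN N) (hD N) x) atTop (𝓝 z) := by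
  obtain ⟨φ, rfl, rfl⟩ := (LinearPMap.mem_graph_iff L).1 hxz
  exact tendsto_iff_norm_sub_tendsto_zero.2 (h φ)

theorem GalerkinStability.norm_exp_apply_le {M ω : ℝ} (h : GalerkinStability L HN hD M ω)
    (hM : 0 ≤ M) (hω : 0 ≤ ω) {T : ℝ} (N : ℕ) {t : ℝ} (ht : t ∈ Icc 0 T) (v : H) :
    ‖NormedSpace.exp ((t : 𝕜) • galerkinOp L (HN N) (hD N)) ((HN N).starProjection v)‖
      ≤ M * Real.exp (ω * T) * ‖v‖ := by
  obtain ⟨TN, hTN⟩ := h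
  obtain ⟨-, h2, h3⟩ := hTN N
  rw [← h2 t ht.1 _ (Submodule.starProjection_apply_mem _ v)]
  refine ((TN N t).le_of_opNorm_le ((h3 t ht.1).trans (mul_le_mul_of_nonneg_left
    (Real.exp_le_exp.2 (mul_le_mul_of_nonneg_left ht.2 hω)) hM)) _).trans ?_
  exact mul_le_mul_of_nonneg_left (Submodule.norm_starProjection_apply_le _ v) (by positivity)

/-! ### Total boundedness -/

/-- A bounded set that is uniformly close to its projections on finite-dimensional subspaces is
totally bounded. -/
theorem totallyBounded_of_starProjection_close {Y : Set H} {b : ℝ}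
    (hb : ∀ v ∈ Y, ‖v‖ ≤ b) (hY : ∀ ε > 0, ∃ N, ∀ v ∈ Y, ‖v - (HN N).starProjection v‖ ≤ ε) :
    TotallyBounded Y := by
  refine Metric.totallyBounded_iff.2 fun ε hε => ?_
  obtain ⟨N, hN⟩ := hY (ε / 3) (by positivity)
  have : ProperSpace (HN N) := FiniteDimensional.proper_rclike 𝕜 (HN N)
  have hcomp : IsCompact ((HN N).subtypeL '' Metric.closedBall 0 b) :=
    (isCompact_closedBall _ _).image (HN N).subtypeL.continuous
  obtain ⟨t, ht, hcov⟩ := Metric.totallyBounded_iff.1 hcomp.totallyBounded (ε / 3) (by positivity)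
  refine ⟨t, ht, fun v hv => ?_⟩
  have hmem : (HN N).starProjection v ∈ (HN N).subtypeL '' Metric.closedBall 0 b := by
    refine ⟨(HN N).orthogonalProjectionOnto v, ?_, (Submodule.starProjection_apply _ v).symm⟩
    have h := (Submodule.norm_starProjection_apply_le (HN N) v).trans (hb v hv)
    rw [Submodule.starProjection_apply] at h
    exact mem_closedBall_zero_iff.2 h
  obtain ⟨p, hp, hvp⟩ := mem_iUnion₂.1 (hcov hmem)
  refine mem_iUnion₂.2 ⟨p, hp, ?_⟩
  rw [Metric.mem_ball] at hvp ⊢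
  have h1 := dist_triangle v ((HN N).starProjection v) p
  have h2 := hN v hv
  rw [← dist_eq_norm] at h2
  linarith

end Galerkin

theorem TotallyBounded.image_of_lipschitzOnWith {X Y : Type*} [PseudoMetricSpace X]
    [PseudoMetricSpace Y] {s : Set X} (hs : TotallyBounded s) {f : X → Y} {κ : NNReal}
    (hf : LipschitzOnWith κ f s) : TotallyBounded (f '' s) := by
  refine Metric.totallyBounded_iff.2 fun ε hε => ?_
  obtain ⟨t, hts, ht, hcov⟩ := Metric.finite_approx_of_totallyBounded hs (ε / (κ + 1))
    (by positivity)
  refine ⟨f '' t, ht.image f, ?_⟩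
  rintro _ ⟨v, hv, rfl⟩
  obtain ⟨p, hp, hvp⟩ := mem_iUnion₂.1 (hcov hv)
  refine mem_iUnion₂.2 ⟨f p, mem_image_of_mem f hp, ?_⟩
  rw [Metric.mem_ball] at hvp ⊢
  refine (hf.dist_le_mul v hv p (hts hp)).trans_lt ?_
  rw [lt_div_iff₀ (by positivity)] at hvp
  nlinarith [dist_nonneg (x := v) (y := p)]

/-! ### The error estimate and uniform convergence -/

section Error

variable {𝕜 H V : Type*} [RCLike 𝕜] [NormedAddCommGroup H] [InnerProductSpace 𝕜 H]
  [CompleteSpace H] [NormedSpace ℝ H] [IsScalarTower ℝ 𝕜 H]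

/-- The Galerkin error for one control: it is governed by the error `η` of the linear flows at the
initial datum, along `F(y)`, and along `C(u)`. -/
theorem IsGalerkinSolution.norm_sub_le {S : ℝ → H →L[𝕜] H} {L : H →ₗ.[𝕜] H} {K : Submodule 𝕜 H}
    [FiniteDimensional 𝕜 K] {hK : K ≤ L.domain} {F : H → H} {C : V → H} {T : ℝ} {x : H}
    {u : ℝ → V} {y z : ℝ → H} (hz : IsGalerkinSolution L K hK F C T x u z)
    (hy : IsMildSolution S F C T x u y) {κ : NNReal} {b c η : ℝ} (hc0 : 0 ≤ c) (hη : 0 ≤ η)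
    (hF : LipschitzOnWith κ F (Metric.closedBall 0 b))
    (hyb : ∀ t ∈ Icc 0 T, ‖y t‖ ≤ b) (hzb : ∀ t ∈ Icc 0 T, ‖z t‖ ≤ b)
    (hc : ∀ t ∈ Icc 0 T, ∀ v,
      ‖NormedSpace.exp ((t : 𝕜) • galerkinOp L K hK) (K.starProjection v)‖ ≤ c * ‖v‖)
    {D : Set H} (hxD : x ∈ D) (hFD : ∀ t ∈ Icc 0 T, F (y t) ∈ D)
    (hCD : ∀ᵐ s, s ∈ Icc 0 T → C (u s) ∈ D)
    (hD : ∀ t ∈ Icc 0 T, ∀ v ∈ D,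
      ‖NormedSpace.exp ((t : 𝕜) • galerkinOp L K hK) (K.starProjection v) - S t v‖ ≤ η) :
    ∀ t ∈ Icc 0 T, ‖z t - y t‖ ≤ η * (1 + 2 * T) * Real.exp (c * κ * T) := by
  intro t₀ ht₀
  have hT : 0 ≤ T := ht₀.1.trans ht₀.2
  set A := galerkinOp L K hK with hA
  set P := K.starProjection with hP
  have hyB : MapsTo y (Icc 0 T) (Metric.closedBall 0 b) := fun t ht =>
    mem_closedBall_zero_iff.2 (hyb t ht)
  have hzB : MapsTo z (Icc 0 T) (Metric.closedBall 0 b) := fun t ht =>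
    mem_closedBall_zero_iff.2 (hzb t ht)
  have hPFy : ContinuousOn (fun s => P (F (y s))) (Icc 0 T) :=
    P.continuous.comp_continuousOn (hF.continuousOn.comp hy.continuousOn hyB)
  have hPFz : ContinuousOn (fun s => P (F (z s))) (Icc 0 T) :=
    P.continuous.comp_continuousOn (hF.continuousOn.comp hz.continuousOn hzB)
  have hAz : ContinuousOn (fun s => A (z s)) (Icc 0 T) :=
    A.continuous.comp_continuousOn hz.continuousOn
  have hr : ContinuousOn (fun s => ‖z s - y s‖) (Icc 0 T) :=
    (hz.continuousOn.sub hy.continuousOn).norm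
  -- the control term is integrable, being what the other terms leave of an integrable function
  have hPC : ∀ t ∈ Icc 0 T, IntervalIntegrable (fun s => P (C (u s))) volume 0 t := by
    intro t ht
    have h1 := (hz.integrable.sub (hAz.intervalIntegrable_left ⟨hT, le_rfl⟩)).sub
      (hPFz.intervalIntegrable_left ⟨hT, le_rfl⟩)
    have h2 : IntervalIntegrable (fun s => P (C (u s))) volume 0 T := by
      convert h1 using 2 with s
      abel
    exact h2.mono_set (by rw [uIcc_of_le ht.1, uIcc_of_le hT]; exact Icc_subset_Icc le_rfl ht.2)
  have key : ∀ t ∈ Icc 0 T, ‖z t - y t‖ ≤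
      η * (1 + 2 * T) + c * κ * ∫ s in (0 : ℝ)..t, ‖z s - y s‖ := by
    intro t ht
    have hsub : ∀ s ∈ Icc 0 t, t - s ∈ Icc 0 T := fun s hs =>
      ⟨by linarith [hs.2], by linarith [hs.1, ht.2]⟩
    have hsT : ∀ s ∈ Icc 0 t, s ∈ Icc 0 T := fun s hs => ⟨hs.1, hs.2.trans ht.2⟩
    have hvar := variation_of_constants A (x := P x) (f := fun s => P (F (z s)) + P (C (u s))) ht.1
      (hz.continuousOn.mono (Icc_subset_Icc le_rfl ht.2))
      ((hPFz.intervalIntegrable_left ht).add (hPC t ht)) (fun s hs => by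
        rw [hz.eq s (hsT s hs)]
        simp only [add_assoc, hA, hP])
    simp only [map_add] at hvar
    have iz : IntervalIntegrable
        (fun s => NormedSpace.exp (((t - s : ℝ) : 𝕜) • A) (P (F (z s)))) volume 0 t :=
      intervalIntegrable_exp_sub_smul_apply A ht.1 (hPFz.intervalIntegrable_left ht)
    have iy : IntervalIntegrable
        (fun s => NormedSpace.exp (((t - s : ℝ) : 𝕜) • A) (P (F (y s)))) volume 0 t :=
      intervalIntegrable_exp_sub_smul_apply A ht.1 (hPFy.intervalIntegrable_left ht)
    have iu : IntervalIntegrable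
        (fun s => NormedSpace.exp (((t - s : ℝ) : 𝕜) • A) (P (C (u s)))) volume 0 t :=
      intervalIntegrable_exp_sub_smul_apply A ht.1 (hPC t ht)
    have hsplit : z t - y t = (NormedSpace.exp ((t : 𝕜) • A) (P x) - S t x)
        + (∫ s in (0 : ℝ)..t, (NormedSpace.exp (((t - s : ℝ) : 𝕜) • A) (P (F (z s)))
            - NormedSpace.exp (((t - s : ℝ) : 𝕜) • A) (P (F (y s)))))
        + (∫ s in (0 : ℝ)..t, (NormedSpace.exp (((t - s : ℝ) : 𝕜) • A) (P (F (y s)))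
            - S (t - s) (F (y s))))
        + ∫ s in (0 : ℝ)..t, (NormedSpace.exp (((t - s : ℝ) : 𝕜) • A) (P (C (u s)))
            - S (t - s) (C (u s))) := by
      rw [hvar, hy.eq t ht, intervalIntegral.integral_add iz iu,
        intervalIntegral.integral_sub iz iy,
        intervalIntegral.integral_sub iy (hy.integrable_F t ht),
        intervalIntegral.integral_sub iu (hy.integrable_C t ht)]
      abel
    have b0 := hD t ht x hxD
    have b1 : ‖∫ s in (0 : ℝ)..t, (NormedSpace.exp (((t - s : ℝ) : 𝕜) • A) (P (F (z s)))
        - NormedSpace.exp (((t - s : ℝ) : 𝕜) • A) (P (F (y s))))‖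
        ≤ c * κ * ∫ s in (0 : ℝ)..t, ‖z s - y s‖ := by
      rw [← intervalIntegral.integral_const_mul]
      refine intervalIntegral.norm_integral_le_of_norm_le ht.1 (Eventually.of_forall fun s hs => ?_)
        ((hr.intervalIntegrable_left ht).const_mul _)
      have hs' := Ioc_subset_Icc_self hs
      rw [← map_sub, ← map_sub, mul_assoc]
      refine (hc _ (hsub s hs') _).trans (mul_le_mul_of_nonneg_left ?_ hc0)
      simpa only [dist_eq_norm] using
        hF.dist_le_mul _ (hzB (hsT s hs')) _ (hyB (hsT s hs'))
    have b2 : ‖∫ s in (0 : ℝ)..t, (NormedSpace.exp (((t - s : ℝ) : 𝕜) • A) (P (F (y s)))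
        - S (t - s) (F (y s)))‖ ≤ η * T := by
      refine (intervalIntegral.norm_integral_le_of_norm_le_const (C := η) fun s hs => ?_).trans ?_
      · rw [uIoc_of_le ht.1] at hs
        have hs' := Ioc_subset_Icc_self hs
        exact hD _ (hsub s hs') _ (hFD s (hsT s hs'))
      · rw [sub_zero, abs_of_nonneg ht.1]
        exact mul_le_mul_of_nonneg_left ht.2 hη
    have b3 : ‖∫ s in (0 : ℝ)..t, (NormedSpace.exp (((t - s : ℝ) : 𝕜) • A) (P (C (u s)))
        - S (t - s) (C (u s)))‖ ≤ η * T := by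
      refine (intervalIntegral.norm_integral_le_of_norm_le_const_ae (C := η) ?_).trans ?_
      · filter_upwards [hCD] with s hsD hs
        rw [uIoc_of_le ht.1] at hs
        have hs' := Ioc_subset_Icc_self hs
        exact hD _ (hsub s hs') _ (hsD (hsT s hs'))
      · rw [sub_zero, abs_of_nonneg ht.1]
        exact mul_le_mul_of_nonneg_left ht.2 hη
    rw [hsplit]
    refine (norm_add_le _ _).trans ?_
    refine (add_le_add_left norm_add₃_le _).trans ?_
    linarith
  refine (le_mul_exp_of_le_add_integral (by positivity) hr key t₀ ht₀).trans ?_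
  gcongr
  exact ht₀.2

end Error

theorem mainTheorem2 {𝕜 H V : Type*} [RCLike 𝕜]
    [NormedAddCommGroup H] [InnerProductSpace 𝕜 H] [CompleteSpace H]
    [TopologicalSpace.SeparableSpace H] [NormedSpace ℝ H] [IsScalarTower ℝ 𝕜 H]
    [NormedAddCommGroup V] [InnerProductSpace 𝕜 V] [CompleteSpace V]
    [TopologicalSpace.SeparableSpace V]
    -- the linear operator `L` generates a `C₀`-semigroup `S`, with `‖S t‖ ≤ M e^{ω t}`
    (L : H →ₗ.[𝕜] H) (S : ℝ → H →L[𝕜] H) (hS : IsC0Semigroup S) (hLS : IsGenerator L S)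
    (M ω : ℝ) (hM : 1 ≤ M) (hω : 0 ≤ ω) (hSb : ∀ t : ℝ, 0 ≤ t → ‖S t‖ ≤ M * Real.exp (ω * t))
    -- the Galerkin subspaces `H_N ⊂ D(L)`, with `Π_N x → x` for all `x`
    (HN : ℕ → Submodule 𝕜 H) [∀ N, FiniteDimensional 𝕜 (HN N)] (hD : ∀ N, HN N ≤ L.domain)
    (hHN : ∀ x : H, Tendsto (fun N => ‖(HN N).starProjection x - x‖) atTop (𝓝 0))
    (hstab : GalerkinStability L HN hD M ω) (hcons : GalerkinConsistency L HN hD)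
    -- the nonlinearities
    (F : H → H) (hF : LipschitzOnBalls F)
    (C : V → H) (hC0 : C 0 = 0) (hC : Continuous C)
    -- the admissible controls
    (q : ℝ≥0∞) (hq : 1 ≤ q) (U : Set V) (hU : IsCompact U)
    (hwell : UniformWellPosedness L S HN hD F C q U)
    (hres : UniformResidualDecay S HN F C q U)
    -- the solutions `y(·;x,u)` and `y_N(·;Π_N x,u)` on `[0,T]`
    (T : ℝ) (hT : 0 < T) (x : H)
    (y : Lp V q (volume.restrict (Icc (0 : ℝ) T)) → ℝ → H)
    (hy : ∀ u ∈ admissibleControls q U T, IsMildSolution S F C T x u (y u))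
    (yN : ℕ → Lp V q (volume.restrict (Icc (0 : ℝ) T)) → ℝ → H)
    (hyN : ∀ N, ∀ u ∈ admissibleControls q U T,
      IsGalerkinSolution L (HN N) (hD N) F C T x u (yN N u)) :
    Tendsto (fun N => ⨆ u ∈ admissibleControls q U T, ⨆ t ∈ Icc (0 : ℝ) T,
      ‖yN N u t - y u t‖ₑ) atTop (𝓝 0) := by
  have hM0 : 0 ≤ M := zero_le_one.trans hM
  have hP : ∀ v, Tendsto (fun N => (HN N).starProjection v) atTop (𝓝 v) := fun v =>
    tendsto_iff_norm_sub_tendsto_zero.2 (hHN v)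
  have hb : ∀ T, ∃ c, ∀ t ∈ Icc 0 T, ‖S t‖ ≤ c := fun T => ⟨M * Real.exp (ω * T), fun t ht =>
    (hSb t ht.1).trans (mul_le_mul_of_nonneg_left
      (Real.exp_le_exp.2 (mul_le_mul_of_nonneg_left ht.2 hω)) hM0)⟩
  set c := M * Real.exp (ω * T) with hcdef
  have hc : ∀ N, ∀ t ∈ Icc 0 T, ∀ v,
      ‖NormedSpace.exp ((t : 𝕜) • galerkinOp L (HN N) (hD N)) ((HN N).starProjection v)‖
        ≤ c * ‖v‖ := fun N t ht v => hstab.norm_exp_apply_le hM0 hω N ht v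
  obtain ⟨B, hB⟩ := (hwell T hT x).2
  -- a positive radius, as the Lipschitz hypothesis is about balls of positive radius
  set b := max B 1 with hbdef
  have hyb : ∀ u ∈ admissibleControls q U T, ∀ t ∈ Icc 0 T, ‖y u t‖ ≤ b := fun u hu t ht =>
    ((hB u hu).1 _ (hy u hu) t ht).trans (le_max_left _ _)
  have hyNb : ∀ N, ∀ u ∈ admissibleControls q U T, ∀ t ∈ Icc 0 T, ‖yN N u t‖ ≤ b :=
    fun N u hu t ht => ((hB u hu).2 N _ (hyN N u hu) t ht).trans (le_max_left _ _)
  obtain ⟨κ, hκ0, hκ⟩ := hF b (lt_max_of_lt_right one_pos)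
  lift κ to NNReal using hκ0.le
  have hFκ : LipschitzOnWith κ F (Metric.closedBall 0 b) :=
    LipschitzOnWith.of_dist_le_mul fun v hv w hw => by
      simpa only [dist_eq_norm] using hκ v hv w hw
  -- the set of all values of all mild solutions is totally bounded
  set Y : Set H := {v | ∃ u ∈ admissibleControls q U T, ∃ t ∈ Icc 0 T, y u t = v} with hYdef
  have hYb : ∀ v ∈ Y, ‖v‖ ≤ b := by
    rintro _ ⟨u, hu, t, ht, rfl⟩
    exact hyb u hu t ht
  have hYtb : TotallyBounded Y := by
    refine totallyBounded_of_starProjection_close (HN := HN) hYb fun ε hε => ?_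
    obtain ⟨N, hN⟩ := (ENNReal.tendsto_nhds_zero.1 (hres T hT x y hy) (ENNReal.ofReal ε)
      (ENNReal.ofReal_pos.2 hε)).exists
    refine ⟨N, ?_⟩
    rintro _ ⟨u, hu, t, ht, rfl⟩
    have h1 := (iSup₂_le_iff.1 (iSup₂_le_iff.1 hN u hu)) t ht
    rwa [← ofReal_norm, ENNReal.ofReal_le_ofReal_iff hε.le] at h1
  -- hence so is the set of all vectors to which the linear flows are applied
  set D : Set H := {x} ∪ F '' Y ∪ C '' U with hDdef
  have hDtb : TotallyBounded D :=
    (isCompact_singleton.totallyBounded.union (hYtb.image_of_lipschitzOnWith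
      (hFκ.mono fun v hv => mem_closedBall_zero_iff.2 (hYb v hv)))).union
      (hU.image hC).totallyBounded
  refine ENNReal.tendsto_nhds_zero.2 fun ε hε => ?_
  obtain ⟨r, hr0, hr⟩ := ENNReal.lt_iff_exists_nnreal_btwn.1 hε
  have hr0' : (0 : ℝ) < r := by exact_mod_cast hr0
  set G := (1 + 2 * T) * Real.exp (c * κ * T) with hG
  have hGpos : 0 < G := by positivity
  filter_upwards [hLS.eventually_norm_exp_sub_lt hS hb
    (dense_domain_of_tendsto_starProjection hD hP)
    (fun N v => galerkinOp_starProjection_apply (HN N) (hD N) v)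
    (fun N v => starProjection_galerkinOp_apply (HN N) (hD N) v) hP
    (fun _ _ h => hcons.tendsto_of_mem_graph h) hT.le hc hDtb (div_pos hr0' hGpos)] with N hN
  refine iSup₂_le fun u hu => iSup₂_le fun t ht => le_trans ?_ hr.le
  have hUae : ∀ᵐ s, s ∈ Icc 0 T → C (u s) ∈ D := by
    filter_upwards [(ae_restrict_iff' measurableSet_Icc).1 hu] with s hs hsT
    exact Or.inr (mem_image_of_mem C (hs hsT))
  have h1 := (hyN N u hu).norm_sub_le (hy u hu) (η := r / G) (c := c) (D := D) (by positivity)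
    (by positivity) hFκ (hyb u hu) (hyNb N u hu) (hc N) (Or.inl (Or.inl rfl))
    (fun s hs => Or.inl (Or.inr (mem_image_of_mem F ⟨u, hu, s, hs, rfl⟩))) hUae
    (fun s hs v hv => (hN s hs v hv).le) t ht
  rw [mul_assoc, ← hG, div_mul_cancel₀ _ hGpos.ne'] at h1
  rw [enorm_le_coe]
  exact_mod_cast h1
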